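/- Let $\mathcal A$ be a semi-abelian category, that is, a category that is pointed, Barr exact, Bourn protomodular (the regular Short Five Lemma holds) and has binary coproducts. Assume that $\mathcal A$ has enough (regular) projectives: for every object $A$ there is a projective presentation, i.e. a regular epimorphism $f\colon B\to A$ with $B$ projective with respect to regular epimorphisms. Let $\mathcal B$ be a Birkhoff subcategory of $\mathcal A$: a full reflective subcategory closed under subobjects and regular quotients, with reflector $b$ and unit $\eta_A\colon A\to bA$. An object $A$ is $b$-perfect if $bA=0$. A regular epimorphism $f\colon B\to A$ is a $b$-trivial extension if the square $\eta_A\circ f=bf\circ\eta_B$ is a pullback, and a $b$-central extension if its pullback along some regular epimorphism $C\to A$ is $b$-trivial. A $b$-central extension $u\colon U\to A$ is universal if for every $b$-central extension $f\colon B\to A$ there is a unique $g\colon U\to B$ with $f\circ g=u$. For an object $B$, let $\mu_B\colon [B,B]_b\to B$ be the kernel of $\eta_B$; each $f\colon B\to A$ induces $[f,f]_b\colon[B,B]_b\to[A,A]_b$. For a projective presentation $f\colon B\to A$ with kernel $K$ and kernel pair $f_0,f_1\colon R[f]\to B$, let $[K,B]_b$ be the kernel of $[f_0,f_0]_b$,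 regarded as a subobject of $[B,B]_b$, and of $K\cap[B,B]_b$, via $[f_1,f_1]_b$. Put $$U(A,b)=\frac{[B,B]_b}{[K,B]_b},\qquad H_2(A,b)=\frac{K\cap[B,B]_b}{[K,B]_b}.$$ Let $u_A^b\colon U(A,b)\to A$ be the morphism induced by $f\circ\mu_B$, and let $H_2(A,b)\to U(A,b)$ be the morphism induced by the inclusion $K\cap[B,B]_b\to[B,B]_b$. **Theorem.** An object $A$ of $\mathcal A$ is $b$-perfect if and only if it admits a universal $b$-central extension. Moreover, if $A$ is $b$-perfect then, for every projective presentation $f\colon B\to A$, the morphism $u_A^b\colon U(A,b)\to A$ is a universal $b$-central extension, and $$0\longrightarrow H_2(A,b)\longrightarrow U(A,b)\xrightarrow{\;u_A^b\;}A\longrightarrow 0$$ is a short exact sequence (the first morphism is a kernel of the second, and the second is a cokernel of the first). -/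

import Mathlib

open CategoryTheory CategoryTheory.Limits

universe v u

namespace RelCentral

/-- A semi-abelian category: pointed (a zero object, with its zero morphisms), regular, Barr exact
(every internal equivalence relation is a kernel pair), Bourn protomodular (the regular Short Five
Lemma holds), with binary coproducts. -/
class SemiAbelian (A : Type u) [Category.{v} A] [HasZeroMorphisms A] : Prop
    extends Regular A, HasZeroObject A, HasBinaryCoproducts A where
  /-- Barr exactness. -/
  exists_isKernelPair {R X : A} (p₁ p₂ : R ⟶ X) (h : IsEquivalenceRelation p₁ p₂) :
    ∃ (Y : A) (f : X ⟶ Y), IsKernelPair f p₁ p₂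
  /-- The regular Short Five Lemma. -/
  shortFive {B' A' B A₀ : A} (f' : B' ⟶ A') (f : B ⟶ A₀) (b : B' ⟶ B) (a : A' ⟶ A₀)
    (w : f' ≫ a = b ≫ f) (hf' : IsRegularEpi f') (hf : IsRegularEpi f)
    (hk : IsIso (kernel.map f' f b a w)) (ha : IsIso a) : IsIso b

section Cokernels

variable {A : Type u} [Category.{v} A] [HasZeroMorphisms A] [SemiAbelian A]

/-- A subobject containing the kernel and the section of a split epimorphism is everything. -/
theorem isIso_of_split {M X Y : A} (p : X ⟶ Y) (s : Y ⟶ X) (hs : s ≫ p = 𝟙 Y)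
    (m : M ⟶ X) [Mono m] (s' : Y ⟶ M) (hs' : s' ≫ m = s)
    (k' : kernel p ⟶ M) (hk' : k' ≫ m = kernel.ι p) : IsIso m := by
  have w : (m ≫ p) ≫ 𝟙 Y = m ≫ p := by simp
  have h1 : IsSplitEpi (m ≫ p) := ⟨⟨⟨s', by rw [← Category.assoc, hs', hs]⟩⟩⟩
  have h2 : IsSplitEpi p := ⟨⟨⟨s, hs⟩⟩⟩
  refine SemiAbelian.shortFive (m ≫ p) p m (𝟙 Y) w inferInstance inferInstance ?_ inferInstance
  refine ⟨kernel.lift (m ≫ p) k' (by rw [← Category.assoc, hk', kernel.condition]), ?_, ?_⟩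
  · rw [← cancel_mono (kernel.ι (m ≫ p)), ← cancel_mono m]
    simp [hk']
  · rw [← cancel_mono (kernel.ι p)]
    simp [hk']

attribute [local simp] pullback.lift_fst pullback.lift_snd prod.lift_fst prod.lift_snd
  pullback.lift_fst_assoc pullback.lift_snd_assoc prod.lift_fst_assoc prod.lift_snd_assoc
  coprod.inl_desc coprod.inr_desc coprod.inl_desc_assoc coprod.inr_desc_assoc

/-- Reflexive relations in a semi-abelian category are difunctional. -/
theorem difunctional {R X : A} (p₁ p₂ : R ⟶ X) (e : ReflexiveRelation p₁ p₂)
    {T : A} (α β γ : T ⟶ R) (h₂ : α ≫ p₂ = β ≫ p₂) (h₁ : β ≫ p₁ = γ ≫ p₁) :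
    ∃ δ : T ⟶ R, δ ≫ p₁ = α ≫ p₁ ∧ δ ≫ p₂ = γ ≫ p₂ := by
  let a : pullback p₂ p₂ ⟶ R := pullback.snd p₂ p₂
  let c : pullback p₁ p₁ ⟶ R := pullback.fst p₁ p₁
  let p : pullback a c ⟶ pullback p₁ p₁ := pullback.snd a c
  let s : pullback p₁ p₁ ⟶ pullback a c :=
    pullback.lift (pullback.lift c c rfl) (𝟙 _) (by simp [a])
  let x : pullback a c ⟶ X := pullback.fst a c ≫ pullback.fst p₂ p₂ ≫ p₁
  let w : pullback a c ⟶ X := pullback.snd a c ≫ pullback.snd p₁ p₁ ≫ p₂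
  have hm : Mono (prod.lift p₁ p₂) := ⟨fun f g h => e.right_cancellation f g
    (by simpa using congrArg (· ≫ prod.fst) h) (by simpa using congrArg (· ≫ prod.snd) h)⟩
  let m := pullback.fst (prod.lift x w) (prod.lift p₁ p₂)
  have hiso : IsIso m := by
    refine isIso_of_split p s (by simp [p, s]) m
      (pullback.lift s (pullback.snd p₁ p₁) ?_)
      (pullback.lift_fst _ _ _)
      (pullback.lift (kernel.ι p) (kernel.ι p ≫ pullback.fst a c ≫ pullback.fst p₂ p₂) ?_)
      (pullback.lift_fst _ _ _)
    · ext
      · simp [x, s, c, pullback.condition]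
      · simp [w, s]
    · have h0 : kernel.ι p ≫ pullback.snd a c = 0 := kernel.condition p
      have h3 : pullback.fst a c ≫ pullback.fst p₂ p₂ ≫ p₂ = pullback.snd a c ≫ c ≫ p₂ := by
        rw [pullback.condition, ← Category.assoc, ← Category.assoc, pullback.condition]
      ext
      · simp [x]
      · simp [w, h3, reassoc_of% h0]
  let t : T ⟶ pullback a c := pullback.lift (pullback.lift α β h₂) (pullback.lift β γ h₁)
    (by simp [a, c])
  have hc := pullback.condition (f := prod.lift x w) (g := prod.lift p₁ p₂)
  refine ⟨t ≫ inv m ≫ pullback.snd (prod.lift x w) (prod.lift p₁ p₂), ?_, ?_⟩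
  · have := congrArg (fun z => t ≫ inv m ≫ z ≫ prod.fst) hc
    simpa [m, t, x] using this.symm
  · have := congrArg (fun z => t ≫ inv m ≫ z ≫ prod.snd) hc
    simpa [m, t, w] using this.symm

/-- Semi-abelian categories are Mal'tsev: reflexive relations are equivalence relations. -/
theorem isEquivalenceRelation_of_reflexive {R X : A} (p₁ p₂ : R ⟶ X)
    (e : ReflexiveRelation p₁ p₂) : IsEquivalenceRelation p₁ p₂ := by
  obtain ⟨s, hs₁, hs₂⟩ := difunctional p₁ p₂ e (p₂ ≫ e.r) (𝟙 R) (p₁ ≫ e.r) (by simp) (by simp)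
  obtain ⟨t, ht₁, ht₂⟩ := difunctional p₁ p₂ e (pullback.fst p₂ p₁)
    (pullback.fst p₂ p₁ ≫ p₂ ≫ e.r) (pullback.snd p₂ p₁) (by simp)
    (by simp [pullback.condition])
  exact ⟨⟨{ e with
    s := s
    symmetry₁ := by simpa using hs₁
    symmetry₂ := by simpa using hs₂
    c := pullback.cone p₂ p₁
    isLimit := pullback.isLimit p₂ p₁
    t := t
    transitivity₁ := ht₁
    transitivity₂ := ht₂ }⟩⟩

/-- Semi-abelian categories have cokernels. -/
instance : HasCokernels A where
  has_colimit {X Y} f := by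
    let g : X ⨿ Y ⟶ Y ⨯ Y := coprod.desc (prod.lift f 0) (prod.lift (𝟙 Y) (𝟙 Y))
    let p₁ : image g ⟶ Y := image.ι g ≫ prod.fst
    let p₂ : image g ⟶ Y := image.ι g ≫ prod.snd
    have e : ReflexiveRelation p₁ p₂ :=
      { right_cancellation := fun _ a b h₁ h₂ => by
          rw [← cancel_mono (image.ι g)]
          ext
          · simpa [p₁] using h₁
          · simpa [p₂] using h₂
        r := coprod.inr ≫ factorThruImage g
        reflexivity₁ := by simp [p₁, g]
        reflexivity₂ := by simp [p₂, g] }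
    obtain ⟨Z, k, hk⟩ := SemiAbelian.exists_isKernelPair p₁ p₂
      (isEquivalenceRelation_of_reflexive p₁ p₂ e)
    have := Regular.hasCoequalizer_of_isKernelPair hk
    let q := coequalizer.π p₁ p₂
    have hf : (coprod.inl ≫ factorThruImage g) ≫ p₁ = f := by simp [p₁, g]
    have h0 : (coprod.inl ≫ factorThruImage g) ≫ p₂ = 0 := by simp [p₂, g]
    have hq : f ≫ q = 0 := by
      rw [← hf, Category.assoc, coequalizer.condition, ← Category.assoc, h0, zero_comp]
    refine ⟨⟨⟨CokernelCofork.ofπ q hq, CokernelCofork.IsColimit.ofπ q hq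
      (fun {W} h hh => coequalizer.desc h ?_) (fun h hh => by simp [q])
      (fun h hh m hm => ?_)⟩⟩⟩
    · rw [← cancel_epi (factorThruImage g)]
      ext
      · simp [p₁, p₂, g, hh]
      · simp [p₁, p₂, g]
    · rw [← cancel_epi q, hm]
      simp [q]

end Cokernels

section Extensions

variable {A : Type u} [Category.{v} A]

/-- A Birkhoff subcategory: a full reflective subcategory (here given by the property `P` of its
objects) that is closed under subobjects and regular quotients. Closure under isomorphisms follows
from closure under subobjects; the reflector is carried by the instance `Reflective P.ι`. -/
class IsBirkhoff (P : ObjectProperty A) [Reflective P.ι] : Prop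
    extends P.IsClosedUnderSubobjects where
  /-- Closure under regular quotients. -/
  prop_of_regularEpi {X Y : A} (f : X ⟶ Y) (hf : IsRegularEpi f) (hX : P X) : P Y

variable (P : ObjectProperty A) [Reflective P.ι]

/-- The reflection of an object of `A` into the subcategory, regarded as an object of `A`. -/
abbrev refl (X : A) : A := ((reflector P.ι).obj X).obj

/-- The action of the reflector on morphisms. -/
abbrev reflMap {X Y : A} (f : X ⟶ Y) : refl P X ⟶ refl P Y := P.ι.map ((reflector P.ι).map f)

/-- The unit of the adjunction. -/
abbrev unit (X : A) : X ⟶ refl P X := (reflectorAdjunction P.ι).unit.app X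

theorem unit_naturality {X Y : A} (f : X ⟶ Y) : unit P X ≫ reflMap P f = f ≫ unit P Y :=
  ((reflectorAdjunction P.ι).unit.naturality f).symm

/-- An object is perfect when its reflection is a zero object of the subcategory. -/
def IsPerfect (X : A) : Prop := IsZero ((reflector P.ι).obj X)

/-- A trivial extension: a regular epimorphism whose naturality square for the unit is a
pullback. -/
def IsTrivialExtension {B X : A} (f : B ⟶ X) : Prop :=
  IsRegularEpi f ∧ IsPullback f (unit P B) (unit P X) (reflMap P f)

/-- A central extension: a regular epimorphism whose pullback along some regular epimorphism is a
trivial extension. -/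
def IsCentralExtension [HasPullbacks A] {B X : A} (f : B ⟶ X) : Prop :=
  IsRegularEpi f ∧ ∃ (C : A) (g : C ⟶ X), IsRegularEpi g ∧
    IsTrivialExtension P (pullback.snd f g)

/-- A universal central extension of `X`: an initial object among the central extensions of `X`
(with morphisms those over `X`). -/
def IsUniversalCentralExtension [HasPullbacks A] {U X : A} (u : U ⟶ X) : Prop :=
  IsCentralExtension P u ∧
    ∀ (B : A) (f : B ⟶ X), IsCentralExtension P f → ∃! g : U ⟶ B, g ≫ f = u

/-- Projectivity relative to regular epimorphisms. -/
def IsRegularProjective (Q : A) : Prop :=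
  ∀ ⦃E X : A⦄ (f : Q ⟶ X) (e : E ⟶ X), IsRegularEpi e → ∃ f' : Q ⟶ E, f' ≫ e = f

/-- A projective presentation of `X`: a regular epimorphism to `X` from a projective object. -/
def IsProjectivePresentation {B X : A} (f : B ⟶ X) : Prop :=
  IsRegularProjective B ∧ IsRegularEpi f

variable (A) in
/-- Every object has a projective presentation. -/
def HasEnoughRegularProjectives : Prop :=
  ∀ X : A, ∃ (B : A) (f : B ⟶ X), IsProjectivePresentation f

/-- A short exact sequence: `k` is a kernel of `f` and `f` is a cokernel of `k`. -/
def IsShortExact [HasZeroMorphisms A] {K B X : A} (k : K ⟶ B) (f : B ⟶ X) : Prop :=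
  ∃ w : k ≫ f = 0, Nonempty (IsLimit (KernelFork.ofι k w)) ∧
    Nonempty (IsColimit (CokernelCofork.ofπ f w))

end Extensions

noncomputable section Commutators

variable {A : Type u} [Category.{v} A] [HasZeroMorphisms A] [SemiAbelian A]
  (P : ObjectProperty A) [Reflective P.ι]

/-- The object `[X, X]`, the kernel of the unit at `X`. -/
abbrev comm₀ (X : A) : A := kernel (unit P X)

/-- The inclusion of `[X, X]` in `X`. -/
def μ (X : A) : comm₀ P X ⟶ X := kernel.ι (unit P X)

/-- The morphism `[f, f] : [B, B] ⟶ [X, X]` induced by `f : B ⟶ X`. -/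
def comm₀Map {B X : A} (f : B ⟶ X) : comm₀ P B ⟶ comm₀ P X :=
  kernel.map (unit P B) (unit P X) f (reflMap P f) (unit_naturality P f)

theorem comm₀Map_μ {B X : A} (f : B ⟶ X) : comm₀Map P f ≫ μ P X = μ P B ≫ f := by
  simp [comm₀Map, μ]

variable {B X : A} (f : B ⟶ X)

/-- The commutator `[K, B]` of `f : B ⟶ X` with kernel `K`: the kernel of `[f₀, f₀]`, where
`f₀`, `f₁` are the two projections of the kernel pair of `f`. -/
abbrev comm₁ : A := kernel (comm₀Map P (pullback.fst f f))

/-- The inclusion of `[K, B]` in `[B, B]`, induced by `[f₁, f₁]`. -/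
def comm₁ToComm₀ : comm₁ P f ⟶ comm₀ P B :=
  kernel.ι (comm₀Map P (pullback.fst f f)) ≫ comm₀Map P (pullback.snd f f)

theorem comm₁ToComm₀_comp : comm₁ToComm₀ P f ≫ μ P B ≫ f = 0 := by
  have h : kernel.ι (comm₀Map P (pullback.fst f f)) ≫ μ P (pullback f f) ≫ pullback.fst f f
      = 0 := by
    rw [← comm₀Map_μ, kernel.condition_assoc, zero_comp]
  rw [comm₁ToComm₀, Category.assoc, ← Category.assoc (comm₀Map P _), comm₀Map_μ,
    Category.assoc, ← pullback.condition, ← Category.assoc (μ P _), ← Category.assoc, h,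
    zero_comp]

/-- The intersection `K ∩ [B, B]` of subobjects of `B`, where `K` is the kernel of `f`. -/
abbrev kerInter : A := pullback (kernel.ι f) (μ P B)

/-- The inclusion of `K ∩ [B, B]` in `[B, B]`. -/
def kerInterToComm₀ : kerInter P f ⟶ comm₀ P B := pullback.snd (kernel.ι f) (μ P B)

/-- The inclusion of `[K, B]` in `K ∩ [B, B]`. -/
def comm₁ToKerInter : comm₁ P f ⟶ kerInter P f :=
  pullback.lift (kernel.lift f (comm₁ToComm₀ P f ≫ μ P B)
    (by rw [Category.assoc, comm₁ToComm₀_comp])) (comm₁ToComm₀ P f) (by simp)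

theorem comm₁ToKerInter_comp :
    comm₁ToKerInter P f ≫ kerInterToComm₀ P f = comm₁ToComm₀ P f := by
  simp [comm₁ToKerInter, kerInterToComm₀, pullback.lift_snd]

/-- The Schur multiplier `H₂ = (K ∩ [B, B]) / [K, B]`, computed from `f : B ⟶ X`. -/
abbrev H₂ : A := cokernel (comm₁ToKerInter P f)

/-- The object `U = [B, B] / [K, B]`, computed from `f : B ⟶ X`. -/
abbrev uce : A := cokernel (comm₁ToComm₀ P f)

/-- The morphism from `H₂` to `U` induced by the inclusion of `K ∩ [B, B]` in `[B, B]`. -/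
def H₂ToUce : H₂ P f ⟶ uce P f :=
  cokernel.desc (comm₁ToKerInter P f) (kerInterToComm₀ P f ≫ cokernel.π (comm₁ToComm₀ P f))
    (by rw [← Category.assoc, comm₁ToKerInter_comp, cokernel.condition])

/-- The morphism from `U` to `X` induced by `[B, B] ⟶ B ⟶ X`. -/
def uceMap : uce P f ⟶ X :=
  cokernel.desc (comm₁ToComm₀ P f) (μ P B ≫ f) (comm₁ToComm₀_comp P f)

end Commutators

end RelCentral

namespace RelCentral

/-! Enough projectives allow arguments with generalized elements, that is, morphisms out of
projective objects: regular epimorphisms are those along which elements lift, monomorphisms those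
with no nonzero element in the kernel. Two facts drive everything. Images of normal subobjects along
regular epimorphisms are normal (`exists_lift_of_comp_cokernel_eq_zero`), so by the Birkhoff
property `[B, B] ⟶ [X, X]` is surjective on elements (`exists_lift_of_comp_unit_eq_zero`). And in a
central extension the projections of the kernel pair agree on the kernel of its unit, so maps into
it with the same composite to the base agree on elements killed by the unit.

For the theorem, `B / [K, B]` is a central extension of `X` (`exists_centralization`), and `U`
embeds in it as the image of `[B, B]`. If `X` is perfect, `U` still covers `X`, hence is central. A
lift of `f` to any central extension kills `[K, B]`, which gives existence; uniqueness holds because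
`U` is itself perfect. Conversely, universality is tested against the central extension `X ⨯ bX ⟶
X`. -/

/-- A monic regular epimorphism is an isomorphism. -/
theorem isIso_of_mono_of_isRegularEpi {A : Type u} [Category.{v} A] {X Y : A} (h : X ⟶ Y) (_ : Mono h) (_ : IsRegularEpi h) :
    IsIso h :=
  isIso_of_mono_of_strongEpi h

/-! ### Regular epimorphisms and projective objects. -/

section Regular

variable {A : Type u} [Category.{v} A] [Regular A]

theorem isRegularEpi_of_comp {X Y Z : A} (f : X ⟶ Y) (g : Y ⟶ Z) (h : IsRegularEpi (f ≫ g)) :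
    IsRegularEpi g := by
  have := strongEpi_of_strongEpi f g
  infer_instance

theorem isRegularEpi_comp {X Y Z : A} (f : X ⟶ Y) (g : Y ⟶ Z) (hf : IsRegularEpi f)
    (hg : IsRegularEpi g) : IsRegularEpi (f ≫ g) := by
  have := strongEpi_comp f g
  infer_instance

/-- Regular epimorphisms are detected by lifting of morphisms from projective objects. -/
theorem isRegularEpi_of_forall_lift (hproj : HasEnoughRegularProjectives A) {Y Z : A} (h : Y ⟶ Z)
    (H : ∀ (T : A), IsRegularProjective T → ∀ t : T ⟶ Z, ∃ s : T ⟶ Y, s ≫ h = t) :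
    IsRegularEpi h := by
  obtain ⟨T, t, hT, ht⟩ := hproj Z
  obtain ⟨s, rfl⟩ := H T hT t
  exact isRegularEpi_of_comp s h ht

end Regular

/-! ### Kernels, difunctionality and normal images in semi-abelian categories. -/

section SemiAbelian

variable {A : Type u} [Category.{v} A] [HasZeroMorphisms A] [SemiAbelian A]

attribute [local simp] pullback.lift_fst pullback.lift_snd prod.lift_fst prod.lift_snd
  pullback.lift_fst_assoc pullback.lift_snd_assoc prod.lift_fst_assoc prod.lift_snd_assoc

/-- A morphism with trivial kernel is a monomorphism. -/
theorem mono_of_kernel_trivial {X Y : A} (h : X ⟶ Y)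
    (H : ∀ (T : A) (t : T ⟶ X), t ≫ h = 0 → t = 0) : Mono h := by
  let d : X ⟶ pullback h h := pullback.lift (𝟙 X) (𝟙 X) rfl
  have hd : d ≫ pullback.fst h h = 𝟙 X := pullback.lift_fst _ _ _
  have : Mono d := mono_of_mono_fac hd
  have h0 : kernel.ι (pullback.fst h h) = 0 := by
    ext
    · simp
    · rw [zero_comp]
      refine H _ _ ?_
      rw [Category.assoc, ← pullback.condition, kernel.condition_assoc, zero_comp]
  -- The first projection has zero kernel, so the diagonal is the whole kernel pair.
  have : IsIso d := isIso_of_split (pullback.fst h h) d hd d (𝟙 X) (Category.id_comp d) 0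
    (by rw [zero_comp, h0])
  have e : pullback.fst h h = pullback.snd h h := by
    rw [← cancel_epi d]
    simp [d]
  refine ⟨fun a b hab => ?_⟩
  have := congrArg (pullback.lift a b hab ≫ ·) e
  simpa using this

theorem mono_of_kernel_trivial_of_projective (hproj : HasEnoughRegularProjectives A) {X Y : A}
    (h : X ⟶ Y) (H : ∀ (T : A), IsRegularProjective T → ∀ t : T ⟶ X, t ≫ h = 0 → t = 0) :
    Mono h := by
  refine mono_of_kernel_trivial h fun T t ht => ?_
  obtain ⟨Q, q, hQ, hq⟩ := hproj T
  rw [← cancel_epi q, comp_zero]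
  exact H Q hQ _ (by rw [Category.assoc, ht, comp_zero])

/-- A morphism that vanishes on the kernel of a regular epimorphism factors through it. -/
theorem exists_desc_of_kernel {X Y Z : A} (e : X ⟶ Y) (he : IsRegularEpi e) (h : X ⟶ Z)
    (hh : ∀ (T : A) (t : T ⟶ X), t ≫ e = 0 → t ≫ h = 0) : ∃ d : Y ⟶ Z, e ≫ d = h := by
  let r₀ := pullback.fst e e
  let r₁ := pullback.snd e e
  let s : X ⟶ pullback e e := pullback.lift (𝟙 X) (𝟙 X) rfl
  have hs : s ≫ r₀ = 𝟙 X := pullback.lift_fst _ _ _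
  have h0 : kernel.ι r₀ ≫ r₀ = 0 := kernel.condition r₀
  -- The equalizer contains the diagonal and the kernel of `r₀`, so it is the whole kernel pair.
  have : IsIso (equalizer.ι (r₀ ≫ h) (r₁ ≫ h)) := isIso_of_split r₀ s hs _
    (equalizer.lift s (by simp [s, r₀, r₁])) (equalizer.lift_ι _ _)
    (equalizer.lift (kernel.ι r₀) (by
      rw [← Category.assoc, h0, zero_comp, ← Category.assoc, hh]
      rw [Category.assoc, ← pullback.condition, ← Category.assoc, h0, zero_comp]))
    (equalizer.lift_ι _ _)
  have hr : r₀ ≫ h = r₁ ≫ h := by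
    rw [← cancel_epi (equalizer.ι (r₀ ≫ h) (r₁ ≫ h))]
    exact equalizer.condition _ _
  refine ⟨IsRegularEpi.desc e h ?_, IsRegularEpi.fac e h _⟩
  have := congrArg (pullback.lift _ _ (IsRegularEpi.w e) ≫ ·) hr
  simpa [r₀, r₁] using this

/-- A regular epimorphism is a cokernel of its kernel. -/
theorem nonempty_isColimit_of_isLimit {K X Y : A} (k : K ⟶ X) (e : X ⟶ Y) (he : IsRegularEpi e)
    (w : k ≫ e = 0) (hk : IsLimit (KernelFork.ofι k w)) :
    Nonempty (IsColimit (CokernelCofork.ofπ e w)) := by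
  have key : ∀ {Z : A} (h : X ⟶ Z), k ≫ h = 0 → ∃ d : Y ⟶ Z, e ≫ d = h := fun h hh =>
    exists_desc_of_kernel e he h fun T t ht => by
      obtain ⟨l, hl⟩ := KernelFork.IsLimit.lift' hk t ht
      have hl : l ≫ k = t := hl
      rw [← hl, Category.assoc, hh, comp_zero]
  exact ⟨CokernelCofork.IsColimit.ofπ e w (fun h hh => (key h hh).choose)
    (fun h hh => (key h hh).choose_spec)
    (fun h hh m hm => by rw [← cancel_epi e, hm, (key h hh).choose_spec])⟩

/-- Relations in a semi-abelian category are difunctional. -/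
theorem difunctional_of_jointlyMono {R X Y : A} (p₁ : R ⟶ X) (p₂ : R ⟶ Y)
    (hm : Mono (prod.lift p₁ p₂)) {T : A} (α β γ : T ⟶ R) (h₂ : α ≫ p₂ = β ≫ p₂)
    (h₁ : β ≫ p₁ = γ ≫ p₁) : ∃ δ : T ⟶ R, δ ≫ p₁ = α ≫ p₁ ∧ δ ≫ p₂ = γ ≫ p₂ := by
  -- `pullback a c` classifies the triples `(α, β, γ)`. The subobject `m`, where the desired `δ`
  -- exists, contains the triples `(β, β, γ)`, with `δ = γ`, and the triples `(α, 0, 0)`, with `δ =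
  -- α`; these are the section and the kernel of `p`.
  let a : pullback p₂ p₂ ⟶ R := pullback.snd p₂ p₂
  let c : pullback p₁ p₁ ⟶ R := pullback.fst p₁ p₁
  let p : pullback a c ⟶ pullback p₁ p₁ := pullback.snd a c
  let s : pullback p₁ p₁ ⟶ pullback a c :=
    pullback.lift (pullback.lift c c rfl) (𝟙 _) (by simp [a])
  let x : pullback a c ⟶ X := pullback.fst a c ≫ pullback.fst p₂ p₂ ≫ p₁
  let w : pullback a c ⟶ Y := pullback.snd a c ≫ pullback.snd p₁ p₁ ≫ p₂
  let m := pullback.fst (prod.lift x w) (prod.lift p₁ p₂)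
  have hiso : IsIso m := by
    refine isIso_of_split p s (by simp [p, s]) m
      (pullback.lift s (pullback.snd p₁ p₁) ?_)
      (pullback.lift_fst _ _ _)
      (pullback.lift (kernel.ι p) (kernel.ι p ≫ pullback.fst a c ≫ pullback.fst p₂ p₂) ?_)
      (pullback.lift_fst _ _ _)
    · ext
      · simp [x, s, c, pullback.condition]
      · simp [w, s]
    · have h0 : kernel.ι p ≫ pullback.snd a c = 0 := kernel.condition p
      have h3 : pullback.fst a c ≫ pullback.fst p₂ p₂ ≫ p₂ = pullback.snd a c ≫ c ≫ p₂ := by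
        rw [pullback.condition, ← Category.assoc, ← Category.assoc, pullback.condition]
      ext
      · simp [x]
      · simp [w, h3, reassoc_of% h0]
  let t : T ⟶ pullback a c := pullback.lift (pullback.lift α β h₂) (pullback.lift β γ h₁)
    (by simp [a, c])
  have hc := pullback.condition (f := prod.lift x w) (g := prod.lift p₁ p₂)
  refine ⟨t ≫ inv m ≫ pullback.snd (prod.lift x w) (prod.lift p₁ p₂), ?_, ?_⟩
  · have := congrArg (fun z => t ≫ inv m ≫ z ≫ prod.fst) hc
    simpa [m, t, x] using this.symm
  · have := congrArg (fun z => t ≫ inv m ≫ z ≫ prod.snd) hc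
    simpa [m, t, w] using this.symm

/-- The direct image of a normal subobject along a regular epimorphism is normal: a morphism from
a projective object that vanishes in the quotient by the image of `kernel q` lifts to
`kernel q`. -/
theorem exists_lift_of_comp_cokernel_eq_zero {B Q X : A} (q : B ⟶ Q) (f : B ⟶ X)
    (hf : IsRegularEpi f) {T : A} (hT : IsRegularProjective T) (x : T ⟶ X)
    (hx : x ≫ cokernel.π (kernel.ι q ≫ f) = 0) : ∃ b : T ⟶ B, b ≫ q = 0 ∧ b ≫ f = x := by
  let r₀ := pullback.fst q q
  let r₁ := pullback.snd q q
  -- The image of the kernel pair of `q` is a reflexive relation on `X`, hence the kernel pair of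
  -- some `k`, and `x` is related to zero by it.
  let g : pullback q q ⟶ X ⨯ X := prod.lift (r₀ ≫ f) (r₁ ≫ f)
  let p₁ : image g ⟶ X := image.ι g ≫ prod.fst
  let p₂ : image g ⟶ X := image.ι g ≫ prod.snd
  have sq : CommSq ((pullback.lift (𝟙 B) (𝟙 B) rfl : B ⟶ pullback q q) ≫ factorThruImage g) f
      (image.ι g) (prod.lift (𝟙 X) (𝟙 X)) :=
    ⟨by ext <;> simp [g, r₀, r₁]⟩
  have e : ReflexiveRelation p₁ p₂ :=
    { right_cancellation := fun _ a b h₁ h₂ => by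
        rw [← cancel_mono (image.ι g)]
        ext
        · simpa [p₁] using h₁
        · simpa [p₂] using h₂
      r := sq.lift
      reflexivity₁ := by simp [p₁]
      reflexivity₂ := by simp [p₂] }
  obtain ⟨Z, k, hk⟩ := SemiAbelian.exists_isKernelPair p₁ p₂
    (isEquivalenceRelation_of_reflexive p₁ p₂ e)
  have hf₁ : factorThruImage g ≫ p₁ = r₀ ≫ f := by simp [p₁, g]
  have hf₂ : factorThruImage g ≫ p₂ = r₁ ≫ f := by simp [p₂, g]
  have hk0 : (kernel.ι q ≫ f) ≫ k = 0 := by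
    have := congrArg ((pullback.lift (kernel.ι q) 0 (by simp) : kernel q ⟶ pullback q q) ≫
      factorThruImage g ≫ ·) hk.w
    simpa [reassoc_of% hf₁, reassoc_of% hf₂, r₀, r₁] using this
  have hxk : x ≫ k = 0 := by
    rw [← cokernel.π_desc _ k hk0, ← Category.assoc, hx, zero_comp]
  obtain ⟨z, hz⟩ := hT (hk.lift 0 x (by simp [hxk])) (factorThruImage g) inferInstance
  have hz₁ : z ≫ r₀ ≫ f = 0 := by rw [← hf₁, ← Category.assoc, hz, hk.lift_fst]
  have hz₂ : z ≫ r₁ ≫ f = x := by rw [← hf₂, ← Category.assoc, hz, hk.lift_snd]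
  -- The element `z` has first component in the kernel of `f`, not yet zero. The relation of pairs
  -- `(b₀, f b₁)` with `q b₀ = q b₁` contains `(0, 0)`, `(z₀, 0)` and `(z₀, x)`, so by
  -- difunctionality it contains `(0, x)`.
  let l : pullback q q ⟶ B ⨯ X := prod.lift r₀ (r₁ ≫ f)
  have hl₁ : factorThruImage l ≫ image.ι l ≫ prod.fst = r₀ := by simp [l]
  have hl₂ : factorThruImage l ≫ image.ι l ≫ prod.snd = r₁ ≫ f := by simp [l]
  obtain ⟨δ, hδ₁, hδ₂⟩ := difunctional_of_jointlyMono (image.ι l ≫ prod.fst)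
    (image.ι l ≫ prod.snd)
    (by rw [← prod.comp_lift, prod.lift_fst_snd, Category.comp_id]; infer_instance) 0
    ((pullback.lift (z ≫ r₀) (z ≫ r₀) rfl : T ⟶ pullback q q) ≫ factorThruImage l)
    (z ≫ factorThruImage l)
    (by rw [Category.assoc, hl₂]; simp [r₁, hz₁])
    (by simp only [Category.assoc, hl₁]; simp [r₀])
  obtain ⟨c, rfl⟩ := hT δ (factorThruImage l) inferInstance
  rw [Category.assoc, hl₁, zero_comp] at hδ₁
  rw [Category.assoc, Category.assoc, hl₂, hz₂] at hδ₂
  refine ⟨c ≫ r₁, ?_, by rw [Category.assoc, hδ₂]⟩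
  rw [Category.assoc, ← pullback.condition, ← Category.assoc, hδ₁, zero_comp]

end SemiAbelian

/-! ### The unit of the reflection. -/

section Reflection

variable {A : Type u} [Category.{v} A] (P : ObjectProperty A) [Reflective P.ι]

/-- Morphisms to objects of the subcategory factor through the unit. -/
theorem exists_refl_desc {X Y : A} (hY : P Y) (g : X ⟶ Y) :
    ∃ g' : refl P X ⟶ Y, unit P X ≫ g' = g := by
  let Y' : P.FullSubcategory := ⟨Y, hY⟩
  let e := (reflectorAdjunction P.ι).homEquiv X Y'
  refine ⟨P.ι.map (e.symm g), ?_⟩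
  exact ((reflectorAdjunction P.ι).homEquiv_unit X Y' (e.symm g)).symm.trans
    (e.apply_symm_apply g)

theorem refl_hom_ext {X Y : A} (hY : P Y) (g h : refl P X ⟶ Y)
    (w : unit P X ≫ g = unit P X ≫ h) : g = h := by
  let Y' : P.FullSubcategory := ⟨Y, hY⟩
  let e := (reflectorAdjunction P.ι).homEquiv X Y'
  have key : ∀ k : refl P X ⟶ Y, e (ObjectProperty.homMk k) = unit P X ≫ k := fun k =>
    (reflectorAdjunction P.ι).homEquiv_unit X Y' _
  have := e.injective ((key g).trans (w.trans (key h).symm))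
  exact congrArg P.ι.map this

theorem prop_refl (X : A) : P (refl P X) := ((reflector P.ι).obj X).property

theorem mono_unit_of_prop {X : A} (hX : P X) : Mono (unit P X) := by
  obtain ⟨g, hg⟩ := exists_refl_desc P hX (𝟙 X)
  exact mono_of_mono_fac hg

/-- Elements in the kernel of the unit are preserved by all morphisms. -/
theorem comp_unit_eq_zero [HasZeroMorphisms A] {T X Y : A} (t : T ⟶ X) (f : X ⟶ Y)
    (ht : t ≫ unit P X = 0) : (t ≫ f) ≫ unit P Y = 0 := by
  rw [Category.assoc, ← unit_naturality, ← Category.assoc, ht, zero_comp]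

/-- An object is perfect if and only if its unit vanishes. -/
theorem isPerfect_iff_unit_eq_zero [HasZeroMorphisms A] (X : A) :
    IsPerfect P X ↔ unit P X = 0 := by
  refine ⟨fun h => ?_, fun h => ?_⟩
  · rw [← Category.comp_id (unit P X)]
    have : 𝟙 ((reflector P.ι).obj X) = ObjectProperty.homMk 0 := h.eq_of_src _ _
    have : 𝟙 (refl P X) = 0 := congrArg P.ι.map this
    rw [this, comp_zero]
  · have h0 : 𝟙 (refl P X) = 0 := refl_hom_ext P (prop_refl P X) _ _ (by simp [h])
    have hz : IsZero (refl P X) := (IsZero.iff_id_eq_zero _).2 h0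
    refine ⟨fun Y => ⟨⟨⟨ObjectProperty.homMk 0⟩, fun f => ?_⟩⟩,
      fun Y => ⟨⟨⟨ObjectProperty.homMk 0⟩, fun f => ?_⟩⟩⟩
    · exact P.ι.map_injective (hz.eq_of_src _ _)
    · exact P.ι.map_injective (hz.eq_of_tgt _ _)

variable [IsBirkhoff P]

/-- The components of the unit are regular epimorphisms. -/
instance isRegularEpi_unit [Regular A] (X : A) : IsRegularEpi (unit P X) := by
  let F := Regular.strongEpiMonoFactorisation (unit P X)
  have hF : F.e ≫ F.m = unit P X := F.fac
  -- The image of the unit lies in the subcategory, so the universal property splits its inclusion.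
  obtain ⟨g, hg⟩ := exists_refl_desc P (P.prop_of_mono F.m (prop_refl P X)) F.e
  have h1 : g ≫ F.m = 𝟙 _ := refl_hom_ext P (prop_refl P X) _ _ (by
    rw [← Category.assoc, hg, hF, Category.comp_id])
  have : IsSplitEpi F.m := ⟨⟨⟨g, h1⟩⟩⟩
  rw [← hF]
  exact isRegularEpi_comp _ _ inferInstance inferInstance

end Reflection

/-! ### Trivial and central extensions. -/

section Central

variable {A : Type u} [Category.{v} A] [HasZeroMorphisms A] [SemiAbelian A]
  (P : ObjectProperty A) [Reflective P.ι]

attribute [local simp] pullback.lift_fst pullback.lift_snd prod.lift_fst prod.lift_snd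
  pullback.lift_fst_assoc pullback.lift_snd_assoc prod.lift_fst_assoc prod.lift_snd_assoc

/-- Regular epimorphisms restrict to regular epimorphisms between the kernels of the units. -/
theorem exists_lift_of_comp_unit_eq_zero [IsBirkhoff P] {B X : A} (f : B ⟶ X)
    (hf : IsRegularEpi f) {T : A} (hT : IsRegularProjective T) (x : T ⟶ X)
    (hx : x ≫ unit P X = 0) : ∃ b : T ⟶ B, b ≫ unit P B = 0 ∧ b ≫ f = x := by
  let q := cokernel.π (kernel.ι (unit P B) ≫ f)
  obtain ⟨r, hr⟩ := exists_desc_of_kernel (unit P B) inferInstance (f ≫ q) fun T t ht => by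
    rw [← kernel.lift_ι _ t ht, Category.assoc, ← Category.assoc (kernel.ι _), cokernel.condition,
      comp_zero]
  -- This cokernel is a regular quotient of `refl P B`, so `q` factors through the unit of `X` and
  -- kills its kernel.
  have hq : P (cokernel (kernel.ι (unit P B) ≫ f)) :=
    IsBirkhoff.prop_of_regularEpi r (isRegularEpi_of_comp (unit P B) r
      (hr ▸ isRegularEpi_comp f q hf inferInstance)) (prop_refl P B)
  obtain ⟨g, hg⟩ := exists_refl_desc P hq q
  exact exists_lift_of_comp_cokernel_eq_zero (unit P B) f hf hT x (by
    change x ≫ q = 0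
    rw [← hg, ← Category.assoc, hx, zero_comp])

/-- A regular epimorphism whose kernel meets the kernel of the unit trivially is a trivial
extension. -/
theorem isTrivialExtension_of_kernel [IsBirkhoff P] (hproj : HasEnoughRegularProjectives A)
    {B X : A} (f : B ⟶ X) (hf : IsRegularEpi f)
    (H : ∀ (T : A) (t : T ⟶ B), t ≫ unit P B = 0 → t ≫ f = 0 → t = 0) :
    IsTrivialExtension P f := by
  refine ⟨hf, ?_⟩
  let c : B ⟶ pullback (unit P X) (reflMap P f) :=
    pullback.lift f (unit P B) (unit_naturality P f).symm
  have w : unit P B ≫ 𝟙 _ = c ≫ pullback.snd (unit P X) (reflMap P f) := by simp [c]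
  -- Short Five over `refl P B`: the kernel comparison is monic by `H`, and elements lift along it
  -- because `[B, B] ⟶ [X, X]` is surjective on elements.
  have hc : IsIso c := by
    refine SemiAbelian.shortFive (unit P B) (pullback.snd (unit P X) (reflMap P f)) c (𝟙 _) w
      inferInstance inferInstance ?_ inferInstance
    refine isIso_of_mono_of_isRegularEpi _ (mono_of_kernel_trivial _ fun T t ht => ?_)
      (isRegularEpi_of_forall_lift hproj _ fun T hT t => ?_)
    · have h1 : t ≫ kernel.ι (unit P B) ≫ c = 0 := by
        rw [← kernel.lift_ι (pullback.snd (unit P X) (reflMap P f)) (kernel.ι (unit P B) ≫ c)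
          (by rw [Category.assoc, ← w]; simp)]
        change t ≫ kernel.map _ _ _ _ w ≫ _ = 0
        rw [← Category.assoc, ht, zero_comp]
      rw [← cancel_mono (kernel.ι (unit P B)), zero_comp]
      refine H _ _ (by simp) ?_
      simpa [c] using congrArg (· ≫ pullback.fst (unit P X) (reflMap P f)) h1
    · let k := kernel.ι (pullback.snd (unit P X) (reflMap P f))
      have hk : k ≫ pullback.snd (unit P X) (reflMap P f) = 0 := kernel.condition _
      obtain ⟨b, hb, hb'⟩ := exists_lift_of_comp_unit_eq_zero P f hf hT
        (t ≫ k ≫ pullback.fst (unit P X) (reflMap P f))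
        (by rw [Category.assoc, Category.assoc, pullback.condition, reassoc_of% hk]; simp)
      refine ⟨kernel.lift _ b hb, ?_⟩
      rw [← cancel_mono k]
      ext
      · simp [k, c, hb']
      · simp [k, c, hb]
  exact IsPullback.of_iso_pullback ⟨(unit_naturality P f).symm⟩ (asIso c) (by simp [c])
    (by simp [c])

/-- In a central extension, the two projections of the kernel pair agree on the kernel of its
unit. -/
theorem IsCentralExtension.eq_of_comp_unit_eq_zero [IsBirkhoff P]
    (hproj : HasEnoughRegularProjectives A) {B X : A}
    {f : B ⟶ X} (hf : IsCentralExtension P f) {T : A} (t : T ⟶ pullback f f)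
    (ht : t ≫ unit P (pullback f f) = 0) : t ≫ pullback.fst f f = t ≫ pullback.snd f f := by
  obtain ⟨-, C, g, hg, -, hp⟩ := hf
  obtain ⟨Q, q, hQ, hq⟩ := hproj T
  let r := pullback.fst (pullback.fst f f ≫ f) g
  have hr : r ≫ pullback.fst f f ≫ f = pullback.snd _ _ ≫ g := pullback.condition
  obtain ⟨s, hs, hs'⟩ := exists_lift_of_comp_unit_eq_zero P r inferInstance hQ (q ≫ t)
    (by rw [Category.assoc, ht, comp_zero])
  let a : pullback (pullback.fst f f ≫ f) g ⟶ pullback f g :=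
    pullback.lift (r ≫ pullback.fst f f) (pullback.snd _ _) ((Category.assoc _ _ _).trans hr)
  let b : pullback (pullback.fst f f ≫ f) g ⟶ pullback f g :=
    pullback.lift (r ≫ pullback.snd f f) (pullback.snd _ _)
      ((Category.assoc _ _ _).trans ((congrArg (r ≫ ·) pullback.condition).symm.trans hr))
  -- After base change along `g` the extension is trivial, so its projection and its unit are
  -- jointly monic; both composites with the unit vanish.
  have hab : s ≫ a = s ≫ b := hp.hom_ext (by simp [a, b])
    (by rw [comp_unit_eq_zero P s a hs, comp_unit_eq_zero P s b hs])
  have := congrArg (· ≫ pullback.fst f g) hab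
  rw [← cancel_epi q, ← Category.assoc, ← hs', ← Category.assoc, ← hs']
  simpa [a, b] using this

/-- A regular epimorphism with trivial commutator is a central extension. -/
theorem isCentralExtension_of_kernel [IsBirkhoff P] (hproj : HasEnoughRegularProjectives A)
    {B X : A} (f : B ⟶ X) (hf : IsRegularEpi f)
    (H : ∀ (T : A), IsRegularProjective T → ∀ t : T ⟶ pullback f f,
      t ≫ unit P (pullback f f) = 0 → t ≫ pullback.snd f f = 0 → t = 0) :
    IsCentralExtension P f := by
  -- The extension is trivialized by pulling back along itself.
  refine ⟨hf, B, f, hf, isTrivialExtension_of_kernel P hproj _ inferInstance fun T t ht ht' => ?_⟩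
  obtain ⟨Q, q, hQ, hq⟩ := hproj T
  rw [← cancel_epi q, comp_zero]
  exact H Q hQ _ (by rw [Category.assoc, ht, comp_zero]) (by rw [Category.assoc, ht', comp_zero])

/-- The projection from a product with an object of the Birkhoff subcategory is central. -/
theorem isCentralExtension_prod_fst [IsBirkhoff P] (hproj : HasEnoughRegularProjectives A)
    (X Y : A) (hY : P Y) : IsCentralExtension P (prod.fst : X ⨯ Y ⟶ X) := by
  have : IsSplitEpi (prod.fst : X ⨯ Y ⟶ X) := ⟨⟨⟨prod.lift (𝟙 X) 0, by simp⟩⟩⟩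
  have := mono_unit_of_prop P hY
  refine isCentralExtension_of_kernel P hproj _ inferInstance fun T _ t ht ht' => ?_
  have h := comp_unit_eq_zero P t (pullback.fst _ _ ≫ prod.snd) ht
  rw [← zero_comp (f := unit P Y), cancel_mono] at h
  have h1 : t ≫ pullback.fst (prod.fst : X ⨯ Y ⟶ X) prod.fst ≫ prod.fst = 0 := by
    rw [pullback.condition, ← Category.assoc, ht', zero_comp]
  ext <;> simp [h, h1, ht']

/-- A subobject of a central extension which still covers the base is a central extension. -/
theorem IsCentralExtension.of_mono [IsBirkhoff P] (hproj : HasEnoughRegularProjectives A)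
    {U B X : A} {f : B ⟶ X} (hf : IsCentralExtension P f) (m : U ⟶ B) [Mono m]
    (hu : IsRegularEpi (m ≫ f)) : IsCentralExtension P (m ≫ f) := by
  refine isCentralExtension_of_kernel P hproj _ hu fun T _ t ht ht' => ?_
  let c : pullback (m ≫ f) (m ≫ f) ⟶ pullback f f :=
    pullback.lift (pullback.fst _ _ ≫ m) (pullback.snd _ _ ≫ m)
      (by simp [pullback.condition])
  have := hf.eq_of_comp_unit_eq_zero P hproj (t ≫ c) (comp_unit_eq_zero P t c ht)
  have h : (t ≫ pullback.fst (m ≫ f) (m ≫ f)) ≫ m = 0 := by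
    simpa [c, reassoc_of% ht'] using this
  rw [← zero_comp (f := m), cancel_mono] at h
  ext <;> simp [h, ht']

/-- An object with a universal central extension is perfect. -/
theorem isPerfect_of_isUniversalCentralExtension [IsBirkhoff P]
    (hproj : HasEnoughRegularProjectives A) {U X : A} (u : U ⟶ X)
    (hu : IsUniversalCentralExtension P u) : IsPerfect P X := by
  have := hu.1.1
  -- Both `(u, η u)` and `(u, 0)` lie over `u`, so `η u = 0`.
  have h := (hu.2 _ _ (isCentralExtension_prod_fst P hproj X _ (prop_refl P X))).unique
    (y₁ := prod.lift u (u ≫ unit P X)) (y₂ := prod.lift u 0) (by simp) (by simp)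
  rw [isPerfect_iff_unit_eq_zero, ← cancel_epi u]
  simpa using congrArg (· ≫ prod.snd) h

end Central

/-! ### The commutator quotient and the universal central extension. -/

section Universal

variable {A : Type u} [Category.{v} A] [HasZeroMorphisms A] [SemiAbelian A]
  (P : ObjectProperty A) [Reflective P.ι] [IsBirkhoff P]

attribute [local simp] pullback.lift_fst pullback.lift_snd prod.lift_fst prod.lift_snd
  pullback.lift_fst_assoc pullback.lift_snd_assoc prod.lift_fst_assoc prod.lift_snd_assoc

variable {B X : A} (f : B ⟶ X)

omit [IsBirkhoff P] in
instance mono_μ (X : A) : Mono (μ P X) :=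
  inferInstanceAs (Mono (kernel.ι (unit P X)))

-- Used to produce elements of `[K, B]` from pairs `(0, y)` in the kernel pair that are killed by
-- its unit.
omit [IsBirkhoff P] in
theorem exists_comm₁_lift {T : A} (b : T ⟶ pullback f f)
    (hb : b ≫ unit P (pullback f f) = 0) (hb' : b ≫ pullback.fst f f = 0) :
    ∃ c : T ⟶ comm₁ P f, c ≫ comm₁ToComm₀ P f ≫ μ P B = b ≫ pullback.snd f f := by
  let b' : T ⟶ comm₀ P (pullback f f) := kernel.lift _ b hb
  have h : b' ≫ μ P (pullback f f) = b := kernel.lift_ι _ _ _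
  have h0 : b' ≫ comm₀Map P (pullback.fst f f) = 0 := by
    rw [← cancel_mono (μ P B), Category.assoc, comm₀Map_μ, ← Category.assoc, h, hb', zero_comp]
  refine ⟨kernel.lift _ b' h0, ?_⟩
  rw [comm₁ToComm₀, Category.assoc, comm₀Map_μ, kernel.lift_ι_assoc, ← Category.assoc, h]

/-- The centralization of a regular epimorphism: its domain is divided by the commutator. -/
theorem exists_centralization (hproj : HasEnoughRegularProjectives A) (hf : IsRegularEpi f) :
    ∃ (E : A) (p : B ⟶ E) (g : E ⟶ X), p ≫ g = f ∧ IsCentralExtension P g ∧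
      ∀ (T : A), IsRegularProjective T → ∀ t : T ⟶ comm₀ P B, t ≫ μ P B ≫ p = 0 →
        ∃ c : T ⟶ comm₁ P f, c ≫ comm₁ToComm₀ P f = t := by
  let r₀ := pullback.fst f f
  let r₁ := pullback.snd f f
  -- The kernel of `q` is `[K, B]` seen inside the kernel pair, so `p` is the quotient of `B` by
  -- `[K, B]`.
  let q : pullback f f ⟶ B ⨯ refl P (pullback f f) := prod.lift r₀ (unit P (pullback f f))
  let p : B ⟶ cokernel (kernel.ι q ≫ r₁) := cokernel.π (kernel.ι q ≫ r₁)
  have hq : ∀ {T : A} (b : T ⟶ pullback f f), b ≫ q = 0 ↔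
      b ≫ unit P (pullback f f) = 0 ∧ b ≫ r₀ = 0 := fun b =>
    ⟨fun h => ⟨by simpa [q] using congrArg (· ≫ prod.snd) h,
      by simpa [q] using congrArg (· ≫ prod.fst) h⟩, fun h => by ext <;> simp [q, h.1, h.2]⟩
  have hp : ∀ {T : A} (b : T ⟶ pullback f f), b ≫ q = 0 → b ≫ r₁ ≫ p = 0 := fun b hb => by
    rw [← kernel.lift_ι q b hb, Category.assoc, ← Category.assoc (kernel.ι q), cokernel.condition,
      comp_zero]
  have hp' : ∀ (T : A), IsRegularProjective T → ∀ t : T ⟶ B, t ≫ p = 0 →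
      ∃ b : T ⟶ pullback f f, b ≫ q = 0 ∧ b ≫ r₁ = t := fun T hT t ht =>
    exists_lift_of_comp_cokernel_eq_zero q r₁ inferInstance hT t ht
  let g : cokernel (kernel.ι q ≫ r₁) ⟶ X := cokernel.desc _ f (by
    rw [Category.assoc, ← pullback.condition, ← Category.assoc,
      ((hq (kernel.ι q)).1 (kernel.condition q)).2, zero_comp])
  have hpg : p ≫ g = f := cokernel.π_desc _ _ _
  have hg : IsRegularEpi g := isRegularEpi_of_comp p g (hpg.symm ▸ hf)
  refine ⟨_, p, g, hpg, ?_, fun T hT t ht => ?_⟩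
  · let φ : pullback f f ⟶ pullback g g :=
      pullback.lift (r₀ ≫ p) (r₁ ≫ p) (by simp [hpg, r₀, r₁, pullback.condition])
    have hφ : IsRegularEpi φ := isRegularEpi_of_forall_lift hproj φ fun T hT t => by
      obtain ⟨a, ha⟩ := hT (t ≫ pullback.fst g g) p inferInstance
      obtain ⟨b, hb⟩ := hT (t ≫ pullback.snd g g) p inferInstance
      refine ⟨pullback.lift a b ?_, ?_⟩
      · rw [← hpg, reassoc_of% ha, reassoc_of% hb, pullback.condition]
      · ext <;> simp [φ, r₀, r₁, ha, hb]
    refine isCentralExtension_of_kernel P hproj g hg fun T hT w hw hw' => ?_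
    obtain ⟨s, hs, rfl⟩ := exists_lift_of_comp_unit_eq_zero P φ hφ hT w hw
    obtain ⟨b, hb, hb'⟩ := hp' T hT (s ≫ r₁) (by simpa [φ] using hw')
    rw [hq] at hb
    let σ : pullback f f ⟶ pullback f f := pullback.lift r₁ r₀ pullback.condition.symm
    let k := μ P (pullback f f)
    have hk : k ≫ unit P _ = 0 := kernel.condition _
    have hm : Mono (prod.lift (k ≫ r₀) (k ≫ r₁)) := ⟨fun x y h => by
      rw [← cancel_mono k]
      ext
      · simpa [r₀] using congrArg (· ≫ prod.fst) h
      · simpa [r₁] using congrArg (· ≫ prod.snd) h⟩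
    -- In the relation `[R[f], R[f]]` on `B`, swapping `b = (0, s₁)` and `s = (s₀, s₁)` gives `(s₁,
    -- 0)` and `(s₁, s₀)`. With `(0, 0)`, difunctionality yields `(0, s₀)`, so `p` kills `s₀`.
    obtain ⟨δ, hδ₁, hδ₂⟩ := difunctional_of_jointlyMono (k ≫ r₀) (k ≫ r₁) hm 0
      (kernel.lift _ (b ≫ σ) (comp_unit_eq_zero P b σ hb.1))
      (kernel.lift _ (s ≫ σ) (comp_unit_eq_zero P s σ hs))
      (by simp [k, μ, σ, r₁, hb.2]) (by simp [k, μ, σ, r₀, hb'])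
    have h1 := hp (δ ≫ k) ((hq _).2 ⟨by rw [Category.assoc, hk, comp_zero], by
      rw [Category.assoc, hδ₁, zero_comp]⟩)
    have h2 : s ≫ r₀ ≫ p = 0 := by
      rw [← h1, Category.assoc, ← Category.assoc k, ← Category.assoc δ, hδ₂]
      simp [k, μ, σ, r₁]
    ext
    · simpa [φ] using h2
    · rw [hw', zero_comp]
  · obtain ⟨b, hb, hb'⟩ := hp' T hT (t ≫ μ P B) (by rw [Category.assoc, ht])
    obtain ⟨c, hc⟩ := exists_comm₁_lift P f b ((hq b).1 hb).1 ((hq b).1 hb).2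
    refine ⟨c, ?_⟩
    rw [← cancel_mono (μ P B), Category.assoc, hc, hb']

/-- A morphism to a central extension of `X` vanishes on the commutator. -/
theorem comm₁ToComm₀_comp_eq_zero (hproj : HasEnoughRegularProjectives A) {C : A} (t : B ⟶ C)
    (h : C ⟶ X) (hh : IsCentralExtension P h) (ht : t ≫ h = f) :
    comm₁ToComm₀ P f ≫ μ P B ≫ t = 0 := by
  let b : comm₁ P f ⟶ pullback f f :=
    kernel.ι (comm₀Map P (pullback.fst f f)) ≫ μ P (pullback f f)
  have hb : b ≫ unit P (pullback f f) = 0 := by simp [b, μ]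
  have hb' : b ≫ pullback.fst f f = 0 := by
    rw [Category.assoc, ← comm₀Map_μ, kernel.condition_assoc, zero_comp]
  let φ : pullback f f ⟶ pullback h h :=
    pullback.lift (pullback.fst f f ≫ t) (pullback.snd f f ≫ t)
      (by simp [ht, pullback.condition])
  have := hh.eq_of_comp_unit_eq_zero P hproj (b ≫ φ) (comp_unit_eq_zero P b φ hb)
  have h2 : b ≫ pullback.snd f f ≫ t = 0 := by
    simpa [φ, reassoc_of% hb'] using this.symm
  rw [← h2, comm₁ToComm₀, Category.assoc, ← Category.assoc (comm₀Map _ _), comm₀Map_μ]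
  simp [b]

omit [IsBirkhoff P] in
@[simp]
theorem π_uceMap : cokernel.π (comm₁ToComm₀ P f) ≫ uceMap P f = μ P B ≫ f :=
  cokernel.π_desc _ _ _

/-- The inclusion of the commutator in `[B, B]` is the kernel of the quotient morphism. -/
theorem exists_lift_of_comp_π_eq_zero (hproj : HasEnoughRegularProjectives A)
    (hf : IsRegularEpi f) {T : A} (hT : IsRegularProjective T) (t : T ⟶ comm₀ P B)
    (ht : t ≫ cokernel.π (comm₁ToComm₀ P f) = 0) :
    ∃ c : T ⟶ comm₁ P f, c ≫ comm₁ToComm₀ P f = t := by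
  obtain ⟨E, p, g, hpg, hg, H⟩ := exists_centralization P f hproj hf
  refine H T hT t ?_
  rw [← cokernel.π_desc _ (μ P B ≫ p) (comm₁ToComm₀_comp_eq_zero P f hproj p g hg hpg),
    ← Category.assoc, ht, zero_comp]

/-- When the unit of `X` vanishes, every element of `X` lifts to `[B, B]`. -/
theorem isRegularEpi_uceMap (hproj : HasEnoughRegularProjectives A) (hf : IsRegularEpi f)
    (hX : unit P X = 0) : IsRegularEpi (uceMap P f) :=
  isRegularEpi_of_forall_lift hproj _ fun T hT t => by
    obtain ⟨b, hb, hb'⟩ := exists_lift_of_comp_unit_eq_zero P f hf hT t (by rw [hX, comp_zero])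
    refine ⟨kernel.lift _ b hb ≫ cokernel.π _, ?_⟩
    rw [Category.assoc, π_uceMap, ← Category.assoc, μ, kernel.lift_ι, hb']

theorem isUniversalCentralExtension_uceMap (hproj : HasEnoughRegularProjectives A)
    (hf : IsProjectivePresentation f) (hX : unit P X = 0) :
    IsUniversalCentralExtension P (uceMap P f) := by
  obtain ⟨hB, hf⟩ := hf
  have hu := isRegularEpi_uceMap P f hproj hf hX
  obtain ⟨E, p, g, hpg, hg, H⟩ := exists_centralization P f hproj hf
  let π := cokernel.π (comm₁ToComm₀ P f)
  let j : uce P f ⟶ E := cokernel.desc _ (μ P B ≫ p)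
    (comm₁ToComm₀_comp_eq_zero P f hproj p g hg hpg)
  have hπj : π ≫ j = μ P B ≫ p := cokernel.π_desc _ _ _
  have hj : Mono j := mono_of_kernel_trivial_of_projective hproj j fun T hT t ht => by
    obtain ⟨s, rfl⟩ := hT t π inferInstance
    obtain ⟨c, rfl⟩ := H T hT s (by rw [← hπj, ← Category.assoc, ht])
    rw [Category.assoc, cokernel.condition, comp_zero]
  have hjg : j ≫ g = uceMap P f := by
    rw [← cancel_epi π, ← Category.assoc, hπj, Category.assoc, hpg]
    exact (π_uceMap P f).symm
  have hU : IsCentralExtension P (uceMap P f) := by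
    rw [← hjg]
    exact hg.of_mono P hproj j (hjg.symm ▸ hu)
  have hμ : μ P B ≫ unit P B = 0 := kernel.condition _
  have key : ∀ {V Y C : A} (h : C ⟶ Y) (_ : IsCentralExtension P h) (a b : V ⟶ C)
      (_ : a ≫ h = b ≫ h) {T : A} (t : T ⟶ V), t ≫ unit P V = 0 → t ≫ a = t ≫ b :=
    fun h hh a b hab T t ht => by
      simpa using hh.eq_of_comp_unit_eq_zero P hproj (t ≫ pullback.lift a b hab)
        (comp_unit_eq_zero P t _ ht)
  -- Since `X` is perfect, `f` lifts to some `t : B ⟶ U` killed by the unit of `U`. By `key`, `p`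
  -- and `t ≫ j` agree on `[B, B]`, so `π` factors through `t`.
  have hperf : unit P (uce P f) = 0 := by
    obtain ⟨t, ht, ht'⟩ := exists_lift_of_comp_unit_eq_zero P (uceMap P f) hu hB f
      (by rw [hX, comp_zero])
    have h1 := key g hg p (t ≫ j) (by rw [hpg, Category.assoc, hjg, ht']) (μ P B) hμ
    have h2 : π = μ P B ≫ t := by rw [← cancel_mono j, hπj, h1, Category.assoc]
    rw [← cancel_epi π, comp_zero, h2, Category.assoc, ht, comp_zero]
  refine ⟨hU, fun C h hh => ?_⟩
  obtain ⟨t, ht⟩ := hB f h hh.1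
  let d : uce P f ⟶ C :=
    cokernel.desc _ (μ P B ≫ t) (comm₁ToComm₀_comp_eq_zero P f hproj t h hh ht)
  have hd : π ≫ d = μ P B ≫ t := cokernel.π_desc _ _ _
  have hdh : d ≫ h = uceMap P f := by
    rw [← cancel_epi π, ← Category.assoc, hd, Category.assoc, ht]
    exact (π_uceMap P f).symm
  refine ⟨d, hdh, fun k hk => ?_⟩
  -- As `U` is perfect, `key` applies to its identity.
  simpa using key h hh k d (hk.trans hdh.symm) (𝟙 _) (by rw [hperf, comp_zero])

theorem isShortExact_uceMap (hproj : HasEnoughRegularProjectives A)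
    (hf : IsRegularEpi f) (hX : unit P X = 0) :
    IsShortExact (H₂ToUce P f) (uceMap P f) := by
  have hu := isRegularEpi_uceMap P f hproj hf hX
  let π := cokernel.π (comm₁ToComm₀ P f)
  let ϖ := cokernel.π (comm₁ToKerInter P f)
  have hπ : π ≫ uceMap P f = μ P B ≫ f := π_uceMap P f
  have hϖ : ϖ ≫ H₂ToUce P f = kerInterToComm₀ P f ≫ π := cokernel.π_desc _ _ _
  have : Mono (kerInterToComm₀ P f) := by
    unfold kerInterToComm₀
    infer_instance
  have w : H₂ToUce P f ≫ uceMap P f = 0 := by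
    rw [← cancel_epi ϖ, ← Category.assoc, hϖ, Category.assoc, hπ, kerInterToComm₀,
      ← Category.assoc, ← pullback.condition]
    simp
  let l : H₂ P f ⟶ kernel (uceMap P f) := kernel.lift _ _ w
  have hl : l ≫ kernel.ι (uceMap P f) = H₂ToUce P f := kernel.lift_ι _ _ w
  -- Injectivity rests on `[K, B]` being all of the kernel of `π`, on elements.
  have hmono : Mono l := mono_of_kernel_trivial_of_projective hproj l fun T hT t ht => by
    obtain ⟨s, rfl⟩ := hT t ϖ inferInstance
    obtain ⟨c, hc⟩ := exists_lift_of_comp_π_eq_zero P f hproj hf hT (s ≫ kerInterToComm₀ P f) (by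
      change (s ≫ kerInterToComm₀ P f) ≫ π = 0
      rw [Category.assoc, ← hϖ, ← Category.assoc, ← hl, ← Category.assoc, ht, zero_comp])
    rw [← comm₁ToKerInter_comp, ← Category.assoc, cancel_mono] at hc
    rw [← hc, Category.assoc, cokernel.condition, comp_zero]
  have hepi : IsRegularEpi l := isRegularEpi_of_forall_lift hproj l fun T hT t => by
    obtain ⟨s, hs⟩ := hT (t ≫ kernel.ι (uceMap P f)) π inferInstance
    have h0 : (s ≫ μ P B) ≫ f = 0 := by
      rw [Category.assoc, ← hπ, ← Category.assoc, hs, Category.assoc, kernel.condition, comp_zero]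
    refine ⟨pullback.lift (kernel.lift f _ h0) s (kernel.lift_ι _ _ _) ≫ ϖ, ?_⟩
    rw [← cancel_mono (kernel.ι (uceMap P f)), Category.assoc, Category.assoc, hl, hϖ,
      kerInterToComm₀, pullback.lift_snd_assoc, hs]
  have := isIso_of_mono_of_isRegularEpi l hmono hepi
  have hlim : IsLimit (KernelFork.ofι (H₂ToUce P f) w) :=
    (kernelIsKernel (uceMap P f)).ofIsoLimit (Fork.ext (asIso l) (by simp [hl])).symm
  exact ⟨w, ⟨hlim⟩, nonempty_isColimit_of_isLimit _ _ hu w hlim⟩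

end Universal

end RelCentral

theorem mainTheorem1 {A : Type u} [Category.{v} A] [HasZeroMorphisms A]
    [RelCentral.SemiAbelian A] (hproj : RelCentral.HasEnoughRegularProjectives A)
    (P : ObjectProperty A) [Reflective P.ι] [RelCentral.IsBirkhoff P] (X : A) :
    (RelCentral.IsPerfect P X ↔
      ∃ (U : A) (u : U ⟶ X), RelCentral.IsUniversalCentralExtension P u) ∧
    (RelCentral.IsPerfect P X →
      ∀ (B : A) (f : B ⟶ X), RelCentral.IsProjectivePresentation f →
        RelCentral.IsUniversalCentralExtension P (RelCentral.uceMap P f) ∧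
        RelCentral.IsShortExact (RelCentral.H₂ToUce P f) (RelCentral.uceMap P f)) := by
  have key : RelCentral.IsPerfect P X →
      ∀ (B : A) (f : B ⟶ X), RelCentral.IsProjectivePresentation f →
        RelCentral.IsUniversalCentralExtension P (RelCentral.uceMap P f) ∧
        RelCentral.IsShortExact (RelCentral.H₂ToUce P f) (RelCentral.uceMap P f) :=
    fun hX B f hf => by
      rw [RelCentral.isPerfect_iff_unit_eq_zero] at hX
      exact ⟨RelCentral.isUniversalCentralExtension_uceMap P f hproj hf hX,
        RelCentral.isShortExact_uceMap P f hproj hf.2 hX⟩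
  refine ⟨⟨fun hX => ?_, fun ⟨U, u, hu⟩ =>
    RelCentral.isPerfect_of_isUniversalCentralExtension P hproj u hu⟩, key⟩
  obtain ⟨B, f, hf⟩ := hproj X
  exact ⟨_, _, (key hX B f hf).1⟩
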